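/- Let $q$ be a prime power and let $\mathbb{F}_q$ carry a total order whose least element is $0$. For $m\ge 1$ let $P_1<P_2<\cdots<P_{q^m}$ be the points of $\mathbb{F}_q^m$ in increasing lexicographic order (first coordinate most significant). For $r\ge 0$ the Reed–Muller code is $$RM_q(r,m)=\{(f(P_1),\dots,f(P_{q^m})) : f\in\mathbb{F}_q[X_1,\dots,X_m],\ \deg f\le r\}.$$ For $\mathbf{x}\in\mathbb{F}_q^n$ and $1\le b\le n$, let $w_b(\mathbf{x})$ be the number of positions $i\in\{1,\dots,n\}$ with $(x_i,x_{i+1},\dots,x_{i+b-1})\ne(0,\dots,0)$, where indices are read cyclically modulo $n$. For a linear code $C\ne\{\mathbf 0\}$ of length $n$, let $d_b(C)=\min\{w_b(\mathbf{c}-\mathbf{c}') : \mathbf{c},\mathbf{c}'\in C,\ \mathbf{c}\neq\mathbf{c}'\}$. Let $m\ge 1$ and $1\le b\le q^m$, and let $r=t(q-1)+s$ with integers $t\ge 0$ and $0\le s<q-1$. If $r\le m(q-1)$, then $$d_b(RM_q(r,m))=\min\{(q-s)q^{m-t-1}+b-1,\ q^m\}.$$ If $r\ge m(q-1)$, then $d_b(RM_q(r,m))=b$.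 -/

import Mathlib

/-- The `b`-symbol support of a word `x = (x_0, …, x_{n-1})`: the set of positions `i` such that the
window `(x_i, x_{i+1}, …, x_{i+b-1})` is nonzero, the indices being read cyclically modulo `n`. -/
def bSymbolSupport {F : Type*} [Zero F] [DecidableEq F] {n : ℕ} (b : ℕ) (x : Fin n → F) :
    Finset (Fin n) :=
  Finset.univ.filter fun i =>
    (fun j : Fin b => x ⟨((i : ℕ) + (j : ℕ)) % n, Nat.mod_lt _ i.pos⟩) ≠ 0

/-- The `b`-symbol weight of a word. -/
def bSymbolWeight {F : Type*} [Zero F] [DecidableEq F] {n : ℕ} (b : ℕ) (x : Fin n → F) : ℕ :=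
  (bSymbolSupport b x).card

/-- The `b`-symbol distance between two words. -/
def bSymbolDist {F : Type*} [AddGroup F] [DecidableEq F] {n : ℕ} (b : ℕ) (x y : Fin n → F) : ℕ :=
  bSymbolWeight b (x - y)

/-- The minimum `b`-symbol distance of a linear code: the least `b`-symbol distance between two
distinct codewords. (For the zero code this is `sInf ∅ = 0`; for every nonzero code and `b ≥ 1`
it is a minimum over a nonempty set, and positive.) -/
noncomputable def minBSymbolDist {F : Type*} [Field F] [DecidableEq F] {n : ℕ} (b : ℕ)
    (C : Submodule F (Fin n → F)) : ℕ :=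
  sInf {d : ℕ | ∃ c ∈ C, ∃ c' ∈ C, c ≠ c' ∧ bSymbolDist b c c' = d}

/-- The number of points of `F ^ m`, with the lexicographic order, is `q ^ m`. -/
theorem card_lex_points (F : Type*) [Fintype F] (m : ℕ) :
    Fintype.card (Lex (Fin m → F)) = Fintype.card F ^ m := by
  rw [Fintype.card_lex, Fintype.card_fun, Fintype.card_fin]

/-- The enumeration `P_0 < P_1 < … < P_{q^m - 1}` of `F ^ m` in increasing lexicographic order
(first coordinate most significant), with respect to a given total order on `F`. -/
noncomputable def lexPoint (F : Type*) [Fintype F] [LinearOrder F] (m : ℕ) :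
    Fin (Fintype.card F ^ m) ≃o Lex (Fin m → F) :=
  monoEquivOfFin (Lex (Fin m → F)) (card_lex_points F m)

/-- Evaluation of polynomials in `m` variables at all points of `F ^ m`, in lexicographic order. -/
noncomputable def evalLexPoints (F : Type*) [Field F] [Fintype F] [LinearOrder F] (m : ℕ) :
    MvPolynomial (Fin m) F →ₗ[F] (Fin (Fintype.card F ^ m) → F) :=
  LinearMap.pi fun i => (MvPolynomial.aeval (ofLex (lexPoint F m i))).toLinearMap

/-- The Reed–Muller code `RM_q(r, m)` over `F = 𝔽_q`: the evaluation vectors at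
`P_0 < P_1 < … < P_{q^m - 1}` of the polynomials in `m` variables of total degree at most `r`. -/
noncomputable def reedMullerCode (F : Type*) [Field F] [Fintype F] [LinearOrder F] (r m : ℕ) :
    Submodule F (Fin (Fintype.card F ^ m) → F) :=
  (MvPolynomial.restrictTotalDegree (Fin m) F r).map (evalLexPoints F m)

/-! Widening the window by one position enlarges a nonempty `b`-symbol support until it is
everything, so a word of Hamming weight `d ≥ 1` has `w_b ≥ min (d + b - 1) n`. A word supported in
the first `d` positions meets this bound. It therefore suffices to find the minimum Hamming weight
of the code and to attain it on an initial segment of positions (`minBSymbolDist_eq`). Lower bound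
on the Hamming weight: if `f` vanishes on `k` of the slices `x i = a`, divide by the `k` factors `X
i - a`. Each of the other `q - k` slices has as many nonzeros of `f` as of the quotient, whose
degree is at most `r - k`. Induction on the dimension and the recursion
`minReedMullerWeight_succ_le` finish the count. Attainment: a product of linear factors whose
support is the box `{0}^t × L × F^(m-t-1)`, with `L` the `q - s` smallest elements of `F`. As `0` is
least, this box is a lexicographic initial segment. -/

/-! ### Cyclic `b`-symbol weights of single words. -/

open Finset in
theorem mem_bSymbolSupport {F : Type*} [Zero F] [DecidableEq F] {n b : ℕ} {x : Fin n → F}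
    {i : Fin n} : i ∈ bSymbolSupport b x ↔
      ∃ j < b, x ⟨((i : ℕ) + j) % n, Nat.mod_lt _ i.pos⟩ ≠ 0 := by
  simp only [bSymbolSupport, mem_filter, mem_univ, true_and, Function.ne_iff, Pi.zero_apply]
  constructor
  · rintro ⟨j, hj⟩
    exact ⟨j, j.2, hj⟩
  · rintro ⟨j, hj, h⟩
    exact ⟨⟨j, hj⟩, h⟩

theorem bSymbolSupport_mono {F : Type*} [Zero F] [DecidableEq F] {n b b' : ℕ} (h : b ≤ b')
    (x : Fin n → F) : bSymbolSupport b x ⊆ bSymbolSupport b' x := by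
  intro i hi
  rw [mem_bSymbolSupport] at hi ⊢
  obtain ⟨j, hj, hx⟩ := hi
  exact ⟨j, hj.trans_le h, hx⟩

theorem bSymbolSupport_one {F : Type*} [Zero F] [DecidableEq F] {n : ℕ} (x : Fin n → F) :
    bSymbolSupport 1 x = Finset.univ.filter fun i => x i ≠ 0 := by
  ext i
  rw [mem_bSymbolSupport]
  simp [Nat.mod_eq_of_lt i.2]

/-- Unless it is everything, the `b`-symbol support of a nonzero word grows with `b`. -/
theorem bSymbolSupport_succ_lt {F : Type*} [Zero F] [DecidableEq F] {n b : ℕ} {x : Fin n → F}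
    (hne : (bSymbolSupport b x).Nonempty) (hun : bSymbolSupport b x ≠ Finset.univ) :
    (bSymbolSupport b x).card < (bSymbolSupport (b + 1) x).card := by
  obtain ⟨c, hc⟩ := hne
  obtain ⟨i, hi⟩ : ∃ i, i ∉ bSymbolSupport b x := by
    by_contra! h
    exact hun (Finset.eq_univ_of_forall h)
  have hn : 0 < n := i.pos
  apply Finset.card_lt_card
  refine (Finset.ssubset_iff_of_subset (bSymbolSupport_mono b.le_succ x)).2 ?_
  by_contra! H
  -- If widening adds nothing, the complement of the support is closed under cyclic successor, so it
  -- spreads from `i` to every position, `c` included.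
  have key : ∀ k : ℕ, (⟨((i : ℕ) + k) % n, Nat.mod_lt _ hn⟩ : Fin n) ∉ bSymbolSupport b x := by
    intro k
    induction k with
    | zero => simpa [Nat.mod_eq_of_lt i.2] using hi
    | succ k ih =>
      intro h
      apply ih
      apply H
      rw [mem_bSymbolSupport] at h ⊢
      obtain ⟨j, hj, hx⟩ := h
      refine ⟨j + 1, by omega, ?_⟩
      convert hx using 3
      simp only [Nat.mod_add_mod]
      congr 1
      omega
  apply key (c + n - i)
  have h1 : (i : ℕ) + (c + n - i) = c + n := by have := i.2; omega
  convert hc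
  rw [h1, Nat.add_mod_right, Nat.mod_eq_of_lt c.2]

/-- Each unit increase of `b` adds at least one position until the support is full. -/
theorem le_bSymbolWeight {F : Type*} [Zero F] [DecidableEq F] {n b : ℕ} {x : Fin n → F}
    (hx : x ≠ 0) (hb : 1 ≤ b) :
    min ((Finset.univ.filter fun i => x i ≠ 0).card + b - 1) n ≤ bSymbolWeight b x := by
  rw [← bSymbolSupport_one]
  obtain ⟨i, hi⟩ := Function.ne_iff.1 hx
  have hi' : i ∈ bSymbolSupport 1 x := by simpa [bSymbolSupport_one] using hi
  induction b, hb using Nat.le_induction with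
  | base => exact (min_le_left _ _).trans (by simp [bSymbolWeight])
  | succ b hb ih =>
    by_cases hun : bSymbolSupport b x = Finset.univ
    · have : bSymbolSupport (b + 1) x = Finset.univ :=
        Finset.eq_univ_of_forall fun j => bSymbolSupport_mono b.le_succ x (hun ▸ Finset.mem_univ j)
      simp [bSymbolWeight, this]
    · have := bSymbolSupport_succ_lt ⟨i, bSymbolSupport_mono hb x hi'⟩ hun
      unfold bSymbolWeight at *
      omega

theorem bSymbolWeight_le_length {F : Type*} [Zero F] [DecidableEq F] {n : ℕ} (b : ℕ)
    (x : Fin n → F) : bSymbolWeight b x ≤ n := by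
  exact (Finset.card_le_univ (bSymbolSupport b x)).trans_eq (Fintype.card_fin n)

/-- A word supported on its first `d` positions has `b`-symbol weight at most `d + b - 1`. -/
theorem bSymbolWeight_le_of_initial {F : Type*} [Zero F] [DecidableEq F] {n b d : ℕ}
    {x : Fin n → F} (hb : 1 ≤ b) (hx : ∀ i, x i ≠ 0 → (i : ℕ) < d) :
    bSymbolWeight b x ≤ d + b - 1 := by
  -- A window meeting the first `d` positions either starts among them or wraps around, and then it
  -- starts among the last `b - 1` positions.
  have hsub : (bSymbolSupport b x).map Fin.valEmbedding ⊆
      Finset.range d ∪ Finset.Ico (n - (b - 1)) n := by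
    intro k hk
    simp only [Finset.mem_map, Fin.valEmbedding_apply] at hk
    obtain ⟨i, hi, rfl⟩ := hk
    obtain ⟨j, hj, hne⟩ := mem_bSymbolSupport.1 hi
    have h := hx _ hne
    simp only [Finset.mem_union, Finset.mem_range, Finset.mem_Ico]
    have := i.2
    rcases lt_or_ge ((i : ℕ) + j) n with h' | h'
    · simp only [Nat.mod_eq_of_lt h'] at h
      omega
    · omega
  have h := (Finset.card_le_card hsub).trans (Finset.card_union_le _ _)
  simp only [Finset.card_map, Finset.card_range, Nat.card_Ico] at h
  unfold bSymbolWeight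
  omega

/-! ### Arithmetic of the Hamming weight bound. -/

/-- The minimum distance of the generalized Reed–Muller code of order `r` in `m` variables. -/
def minReedMullerWeight (q r m : ℕ) : ℕ :=
  if r / (q - 1) < m then (q - r % (q - 1)) * q ^ (m - r / (q - 1) - 1) else 1

theorem minReedMullerWeight_pos {q : ℕ} (hq : 2 ≤ q) (r m : ℕ) :
    0 < minReedMullerWeight q r m := by
  unfold minReedMullerWeight
  split_ifs
  · have := Nat.mod_lt r (show 0 < q - 1 by omega)
    exact Nat.mul_pos (by omega) (by positivity)
  · exact one_pos

theorem minReedMullerWeight_eq {q t s : ℕ} (hs : s < q - 1) (m : ℕ) :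
    minReedMullerWeight q (t * (q - 1) + s) m =
      if t < m then (q - s) * q ^ (m - t - 1) else 1 := by
  have h1 : (t * (q - 1) + s) / (q - 1) = t := by
    rw [mul_comm, Nat.mul_add_div (by omega), Nat.div_eq_of_lt hs, add_zero]
  have h2 : (t * (q - 1) + s) % (q - 1) = s := by
    rw [mul_comm, Nat.mul_add_mod, Nat.mod_eq_of_lt hs]
  rw [minReedMullerWeight, h1, h2]

/-- The numerical form of slicing: `k` is the number of slices on which the polynomial vanishes, and
`r - k` bounds the degree left on the others. -/
theorem minReedMullerWeight_succ_le {q r k : ℕ} (hq : 2 ≤ q) (hkr : k ≤ r) (hkq : k < q) (m : ℕ) :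
    minReedMullerWeight q r (m + 1) ≤ (q - k) * minReedMullerWeight q (r - k) m := by
  obtain ⟨t, s, hs, rfl⟩ : ∃ t s, s < q - 1 ∧ r = t * (q - 1) + s :=
    ⟨r / (q - 1), r % (q - 1), Nat.mod_lt _ (by omega), by rw [mul_comm, Nat.div_add_mod]⟩
  rw [minReedMullerWeight_eq hs]
  split_ifs with htm
  swap
  · exact Nat.mul_pos (by omega) (minReedMullerWeight_pos hq _ _)
  -- Without a borrow the claim is `(q - s) q ≤ (q - k) (q - s + k)`, with difference `k (s - k)`,
  -- except that at `t = m` the inner weight is 1. With a borrow from `t` it is `q - s ≤ (q - k) (k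
  -- - s + 1)`, with difference `(q - k - 1) (k - s)`.
  rcases le_or_gt k s with hks | hks
  · rw [Nat.add_sub_assoc hks, minReedMullerWeight_eq (by omega)]
    split_ifs with h
    · obtain ⟨e, rfl⟩ : ∃ e, m = t + 1 + e := ⟨m - t - 1, by omega⟩
      obtain ⟨v, rfl⟩ : ∃ v, s = k + v := ⟨s - k, by omega⟩
      obtain ⟨u, rfl⟩ : ∃ u, q = k + v + u := ⟨q - k - v, by omega⟩
      have e1 : t + 1 + e + 1 - t - 1 = e + 1 := by omega
      have e2 : t + 1 + e - t - 1 = e := by omega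
      have e3 : k + v + u - (k + v) = u := by omega
      have e4 : k + v + u - k = v + u := by omega
      have e5 : k + v + u - (k + v - k) = k + u := by omega
      rw [e1, e2, e3, e4, e5, pow_succ', ← mul_assoc, ← mul_assoc]
      apply Nat.mul_le_mul_right
      nlinarith [Nat.zero_le (k * v)]
    · have : m = t := by omega
      subst this
      simp
      omega
  · obtain ⟨t, rfl⟩ : ∃ t', t = t' + 1 := by
      refine ⟨t - 1, ?_⟩
      rcases Nat.eq_zero_or_pos t with rfl | h
      · omega
      · omega
    have e0 : (t + 1) * (q - 1) + s - k = t * (q - 1) + (q - 1 + s - k) := by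
      rw [add_mul]; omega
    rw [e0, minReedMullerWeight_eq (by omega), if_pos (by omega)]
    have e1 : m + 1 - (t + 1) - 1 = m - t - 1 := by omega
    rw [e1, ← mul_assoc]
    apply Nat.mul_le_mul_right
    obtain ⟨v, rfl⟩ : ∃ v, k = s + 1 + v := ⟨k - s - 1, by omega⟩
    obtain ⟨u, rfl⟩ : ∃ u, q = s + 1 + v + (u + 1) := ⟨q - (s + 1 + v) - 1, by omega⟩
    have e2 : s + 1 + v + (u + 1) - s = v + u + 2 := by omega
    have e3 : s + 1 + v + (u + 1) - (s + 1 + v) = u + 1 := by omega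
    have e4 : s + 1 + v + (u + 1) - (s + 1 + v + (u + 1) - 1 + s - (s + 1 + v)) = v + 2 := by
      omega
    rw [e2, e3, e4]
    nlinarith [Nat.zero_le (u * v)]

/-! ### Lower bound for the number of nonzeros of a polynomial. -/

/-- Division of a polynomial by `X i - a`, in terms of values. -/
theorem exists_totalDegree_le_eval_sub_eval_update {σ R : Type*} [DecidableEq σ] [CommRing R]
    (i : σ) (a : R) {r : ℕ} (f : MvPolynomial σ R) (hf : f.totalDegree ≤ r + 1) :
    ∃ g : MvPolynomial σ R, g.totalDegree ≤ r ∧ ∀ x : σ → R,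
      MvPolynomial.eval x f - MvPolynomial.eval (Function.update x i a) f =
        (x i - a) * MvPolynomial.eval x g := by
  have mono : ∀ d ∈ f.support, ∃ g : MvPolynomial σ R, g.totalDegree ≤ r ∧ ∀ x : σ → R,
      MvPolynomial.eval x (MvPolynomial.monomial d (f.coeff d)) -
        MvPolynomial.eval (Function.update x i a) (MvPolynomial.monomial d (f.coeff d)) =
        (x i - a) * MvPolynomial.eval x g := by
    intro d hd
    have hdeg : d.degree ≤ r + 1 := (MvPolynomial.le_totalDegree hd).trans hf
    have hsplit : d = d.erase i + Finsupp.single i (d i) := by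
      rw [Finsupp.erase_add_single]
    have hdeg' : (d.erase i).degree + d i = d.degree := by
      conv_rhs => rw [hsplit, map_add, Finsupp.degree_single]
    have hev : ∀ (x : σ → R) (j : ℕ) (c : R),
        MvPolynomial.eval x (MvPolynomial.monomial (d.erase i + Finsupp.single i j) c) =
          c * ((d.erase i).prod fun k e => x k ^ e) * x i ^ j := by
      intro x j c
      rw [MvPolynomial.eval_monomial, Finsupp.prod_add_index' (by simp) (by simp [pow_add]),
        Finsupp.prod_single_index (by simp), mul_assoc]
    have hup : ∀ x : σ → R, ((d.erase i).prod fun k e => Function.update x i a k ^ e) =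
        (d.erase i).prod fun k e => x k ^ e := by
      intro x
      refine Finsupp.prod_congr fun k hk => ?_
      have : k ≠ i := by
        rintro rfl
        simp at hk
      rw [Function.update_of_ne this]
    -- The quotient comes from the geometric sum for `x i ^ d i - a ^ d i`.
    refine ⟨∑ j ∈ Finset.range (d i), MvPolynomial.monomial (d.erase i + Finsupp.single i j)
      (f.coeff d * a ^ (d i - 1 - j)), ?_, ?_⟩
    · refine MvPolynomial.totalDegree_finsetSum_le fun j hj => ?_
      refine (MvPolynomial.totalDegree_monomial_le _ _).trans ?_
      rw [Finset.mem_range] at hj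
      change (d.erase i + Finsupp.single i j).degree ≤ r
      rw [map_add, Finsupp.degree_single]
      omega
    · intro x
      conv_lhs => rw [hsplit]
      rw [hev, hev, hup, Function.update_self, map_sum, ← hsplit]
      simp_rw [hev]
      rw [← mul_sub, ← (Commute.all (x i) a).geom_sum₂_mul, mul_comm _ (x i - a), mul_left_comm,
        Finset.mul_sum]
      congr 1
      refine Finset.sum_congr rfl fun j _ => ?_
      ring
  choose! g hg using mono
  refine ⟨∑ d ∈ f.support, g d, MvPolynomial.totalDegree_finsetSum_le fun d hd => (hg d hd).1, ?_⟩
  intro x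
  conv_lhs => rw [f.as_sum]
  rw [map_sum, map_sum, map_sum, ← Finset.sum_sub_distrib, Finset.mul_sum]
  exact Finset.sum_congr rfl fun d hd => (hg d hd).2 x

/-- A polynomial vanishing on the parts `x i = a`, `a ∈ A`, of a cylinder `S` in direction `i`
is divisible by `∏ a ∈ A, (X i - a)` there. -/
theorem exists_eval_eq_prod_mul_eval {σ F : Type*} [DecidableEq σ] [DecidableEq F] [Field F]
    (i : σ) {S : Set (σ → F)} (hS : ∀ x ∈ S, ∀ a, Function.update x i a ∈ S) {r : ℕ}
    {f : MvPolynomial σ F} (hf : f.totalDegree ≤ r) {x₀ : σ → F} (hx₀ : x₀ ∈ S)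
    (hfx₀ : MvPolynomial.eval x₀ f ≠ 0) (A : Finset F)
    (hA : ∀ x ∈ S, x i ∈ A → MvPolynomial.eval x f = 0) :
    A.card ≤ r ∧ ∃ g : MvPolynomial σ F, g.totalDegree ≤ r - A.card ∧
      ∀ x ∈ S, MvPolynomial.eval x f = (∏ a ∈ A, (x i - a)) * MvPolynomial.eval x g := by
  induction A using Finset.induction_on with
  | empty => exact ⟨by simp, f, by simpa using hf, by simp⟩
  | insert a A ha ih =>
    obtain ⟨hcard, g, hg, hfg⟩ := ih fun x hx h => hA x hx (Finset.mem_insert_of_mem h)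
    -- On the slice `x i = a` the factors already removed are nonzero, so the quotient `g` vanishes
    -- there and can be divided again.
    have hga : ∀ x ∈ S, MvPolynomial.eval (Function.update x i a) g = 0 := by
      intro x hx
      have h1 := hA _ (hS x hx a) (by simp)
      rw [hfg _ (hS x hx a), Function.update_self, mul_eq_zero] at h1
      refine h1.resolve_left (Finset.prod_ne_zero_iff.2 fun c hc => ?_)
      rw [sub_ne_zero]
      rintro rfl
      exact ha hc
    rw [Finset.card_insert_of_notMem ha]
    -- If no degree were left, `g` would be a constant with a zero, which forces `f` to vanish at
    -- `x₀`.
    have hlt : A.card < r := by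
      by_contra! h
      have h0 : g.totalDegree = 0 := by omega
      have h1 := hga x₀ hx₀
      apply hfx₀
      rw [hfg x₀ hx₀]
      rw [MvPolynomial.totalDegree_eq_zero_iff_eq_C.1 h0] at h1 ⊢
      simp only [MvPolynomial.eval_C] at h1 ⊢
      rw [h1, mul_zero]
    obtain ⟨g', hg', hgg'⟩ := exists_totalDegree_le_eval_sub_eval_update i a
      (r := r - (A.card + 1)) g (by omega)
    refine ⟨hlt, g', hg', fun x hx => ?_⟩
    have h := hgg' x
    rw [hga x hx, sub_zero] at h
    rw [hfg x hx, h, Finset.prod_insert ha]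
    ring

/-- On the flat through `x₀` in the coordinate directions `I`, a polynomial of degree at most `r`
which is nonzero at `x₀` has at least `minReedMullerWeight q r #I` nonzeros. -/
theorem minReedMullerWeight_le_card_flat {σ F : Type*} [Fintype σ] [DecidableEq σ] [DecidableEq F]
    [Field F] [Fintype F] (I : Finset σ) (r : ℕ) (f : MvPolynomial σ F)
    (hf : f.totalDegree ≤ r) (x₀ : σ → F) (hx₀ : MvPolynomial.eval x₀ f ≠ 0) :
    minReedMullerWeight (Fintype.card F) r I.card ≤
      (Finset.univ.filter fun x : σ → F =>
        (∀ j ∉ I, x j = x₀ j) ∧ MvPolynomial.eval x f ≠ 0).card := by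
  have hq : 2 ≤ Fintype.card F := Fintype.one_lt_card
  induction I using Finset.induction_on generalizing r f x₀ with
  | empty =>
    simp only [minReedMullerWeight, Finset.card_empty, Nat.not_lt_zero, if_false]
    exact Finset.card_pos.2 ⟨x₀, by simpa using hx₀⟩
  | insert i I hi ih =>
    let S : Set (σ → F) := {x | ∀ j ∉ insert i I, x j = x₀ j}
    have hS : ∀ x ∈ S, ∀ a, Function.update x i a ∈ S := by
      intro x hx a j hj
      have : j ≠ i := by
        rintro rfl
        simp at hj
      rw [Function.update_of_ne this]
      exact hx j hj
    let A : Finset F := Finset.univ.filter fun a => ∀ x ∈ S, x i = a → MvPolynomial.eval x f = 0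
    obtain ⟨hcard, g, hg, hfg⟩ := exists_eval_eq_prod_mul_eval i hS hf (x₀ := x₀)
      (fun j _ => rfl) hx₀ A (fun x hx h => (Finset.mem_filter.1 h).2 x hx rfl)
    have hAlt : A.card < Fintype.card F := by
      apply Finset.card_lt_univ_of_notMem (x := x₀ i)
      intro h
      exact hx₀ ((Finset.mem_filter.1 h).2 x₀ (fun j _ => rfl) rfl)
    rw [Finset.card_insert_of_notMem hi]
    refine (minReedMullerWeight_succ_le hq hcard hAlt I.card).trans ?_
    have hc : Fintype.card F - A.card = (Aᶜ).card := (Finset.card_compl A).symm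
    rw [hc, ← smul_eq_mul]
    refine le_trans (Finset.card_nsmul_le_sum _ (fun a => ((Finset.univ.filter fun x : σ → F =>
      (∀ j ∉ insert i I, x j = x₀ j) ∧ MvPolynomial.eval x f ≠ 0).filter fun x => x i = a).card)
      _ ?_) ?_
    -- Off `A` the removed product is a nonzero constant on the slice, so the nonzeros of `f` there
    -- are those of `g`. The induction hypothesis applies to `g` on the flat through `y`.
    · intro a ha
      have : ∃ y ∈ S, y i = a ∧ MvPolynomial.eval y f ≠ 0 := by
        simpa [A] using ha
      obtain ⟨y, hyS, hya, hyf⟩ := this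
      have hyg : MvPolynomial.eval y g ≠ 0 := by
        rw [hfg y hyS] at hyf
        exact right_ne_zero_of_mul hyf
      refine (ih _ g hg y hyg).trans (Finset.card_le_card fun x hx => ?_)
      simp only [Finset.mem_filter, Finset.mem_univ, true_and] at hx ⊢
      have hxa : x i = a := (hx.1 i hi).trans hya
      have hxS : x ∈ S := by
        intro j hj
        rw [hx.1 j fun h => hj (Finset.mem_insert_of_mem h)]
        exact hyS j hj
      refine ⟨⟨hxS, ?_⟩, hxa⟩
      rw [hfg x hxS]
      refine mul_ne_zero (Finset.prod_ne_zero_iff.2 fun c hc => ?_) hx.2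
      rw [hxa, sub_ne_zero]
      rintro rfl
      exact Finset.mem_compl.1 ha hc
    · rw [Finset.sum_card_fiberwise_eq_card_filter]
      exact Finset.card_le_card (Finset.filter_subset _ _)

theorem minReedMullerWeight_le_card {σ F : Type*} [Fintype σ] [DecidableEq σ] [DecidableEq F]
    [Field F] [Fintype F] {r : ℕ} {f : MvPolynomial σ F}
    (hf : f.totalDegree ≤ r) {x₀ : σ → F} (hx₀ : MvPolynomial.eval x₀ f ≠ 0) :
    minReedMullerWeight (Fintype.card F) r (Fintype.card σ) ≤
      (Finset.univ.filter fun x : σ → F => MvPolynomial.eval x f ≠ 0).card := by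
  simpa using minReedMullerWeight_le_card_flat Finset.univ r f hf x₀ hx₀

/-! ### From polynomials to codewords. -/

theorem mem_reedMullerCode {F : Type*} [Field F] [Fintype F] [LinearOrder F] {r m : ℕ}
    {c : Fin (Fintype.card F ^ m) → F} : c ∈ reedMullerCode F r m ↔
      ∃ f : MvPolynomial (Fin m) F, f.totalDegree ≤ r ∧
        c = fun i => MvPolynomial.eval (ofLex (lexPoint F m i)) f := by
  simp only [reedMullerCode, Submodule.mem_map, MvPolynomial.mem_restrictTotalDegree]
  refine exists_congr fun f => and_congr_right fun _ => ?_
  rw [eq_comm]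
  rfl

theorem le_card_support_of_mem_reedMullerCode {F : Type*} [Field F] [Fintype F] [LinearOrder F]
    {r m : ℕ} {c : Fin (Fintype.card F ^ m) → F} (hc : c ∈ reedMullerCode F r m) (h0 : c ≠ 0) :
    minReedMullerWeight (Fintype.card F) r m ≤ (Finset.univ.filter fun i => c i ≠ 0).card := by
  obtain ⟨f, hf, rfl⟩ := mem_reedMullerCode.1 hc
  obtain ⟨i, hi⟩ := Function.ne_iff.1 h0
  have h := minReedMullerWeight_le_card hf hi
  rw [Fintype.card_fin] at h
  refine h.trans (le_of_eq (Eq.symm ?_))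
  refine Finset.card_bij (fun i _ => ofLex (lexPoint F m i)) ?_ ?_ ?_
  · intro i hi
    simpa using hi
  · intro i _ j _ hij
    exact (lexPoint F m).injective (ofLex.injective hij)
  · intro x hx
    refine ⟨(lexPoint F m).symm (toLex x), ?_, ?_⟩
    · simpa using hx
    · simp

/-! ### A light codeword on an initial segment. -/

/-- The `k` smallest elements of a finite linear order. -/
theorem exists_isLowerSet_card_eq (α : Type*) [Fintype α] [LinearOrder α] {k : ℕ}
    (hk : k ≤ Fintype.card α) : ∃ L : Finset α, IsLowerSet (L : Set α) ∧ L.card = k := by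
  let e := monoEquivOfFin α rfl
  refine ⟨Finset.univ.filter fun a => ((e.symm a : Fin _) : ℕ) < k, ?_, ?_⟩
  · intro a b hba ha
    simp only [Finset.coe_filter, Finset.mem_univ, true_and, Set.mem_ofPred_eq] at ha ⊢
    exact lt_of_le_of_lt (e.symm.monotone hba) ha
  · have : (Finset.univ.filter fun a => ((e.symm a : Fin _) : ℕ) < k).card =
        (Finset.univ.filter fun i : Fin (Fintype.card α) => (i : ℕ) < k).card := by
      refine Finset.card_equiv e.symm.toEquiv fun a => ?_
      simp
    rw [this, Fin.card_filter_val_lt, min_eq_right hk]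

theorem val_lt_card_of_isLowerSet {n : ℕ} {L : Finset (Fin n)} (hL : IsLowerSet (L : Set (Fin n)))
    {i : Fin n} (hi : i ∈ L) : (i : ℕ) < L.card := by
  have h : Finset.Iic i ⊆ L := fun j hj => hL (Finset.mem_Iic.1 hj) hi
  have := Finset.card_le_card h
  rw [Fin.card_Iic] at this
  omega

/-- A box with sides `{0}` (before `t`), `L` (at `t`) and everything (after `t`). -/
def initialBox {F : Type*} [Zero F] [Fintype F] (L : Finset F) (t m : ℕ) (j : Fin m) : Finset F :=
  if (j : ℕ) < t then {0} else if (j : ℕ) = t then L else Finset.univ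

/-- At the first coordinate where `y` and `x` differ, `y` is smaller. That coordinate cannot precede
`t`, where `x` is already `0`; at `t` it stays in `L`; all later coordinates are free. -/
theorem isLowerSet_initialBox {F : Type*} [Zero F] [Fintype F] [LinearOrder F]
    (hzero : ∀ a : F, 0 ≤ a) {L : Finset F} (hL : IsLowerSet (L : Set F)) {t m : ℕ}
    {x y : Fin m → F} (hyx : toLex y ≤ toLex x) (hx : ∀ j, x j ∈ initialBox L t m j) :
    ∀ j, y j ∈ initialBox L t m j := by
  rcases hyx.eq_or_lt with h | ⟨i, heq, hlt⟩
  · rwa [toLex.injective h]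
  intro j
  simp only [Pi.toLex_apply] at heq hlt
  rcases lt_trichotomy j i with hj | rfl | hj
  · rw [heq j hj]
    exact hx j
  · have := hx j
    unfold initialBox at this ⊢
    split_ifs at this ⊢
    · rw [Finset.mem_singleton.1 this] at hlt
      exact absurd hlt (hzero _).not_gt
    · exact hL hlt.le this
    · simp
  · have hi := hx i
    unfold initialBox at hi ⊢
    have hit : t ≤ i := by
      by_contra! h
      rw [if_pos h, Finset.mem_singleton] at hi
      rw [hi] at hlt
      exact absurd hlt (hzero _).not_gt
    have : (i : ℕ) < j := hj
    rw [if_neg (by omega), if_neg (by omega)]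
    simp

theorem card_initialBox {F : Type*} [Zero F] [Fintype F] (L : Finset F) (t m : ℕ) :
    ∏ j, (initialBox L t m j).card =
      if t < m then L.card * Fintype.card F ^ (m - t - 1) else 1 := by
  have h : ∀ j : Fin m, (initialBox L t m j).card =
      (fun k : ℕ => if k < t then 1 else if k = t then L.card else Fintype.card F) j := by
    intro j
    simp only [initialBox]
    split_ifs <;> simp
  rw [Finset.prod_congr rfl fun j _ => h j,
    Fin.prod_univ_eq_prod_range
      (fun k : ℕ => if k < t then 1 else if k = t then L.card else Fintype.card F) m]
  split_ifs with htm
  · obtain ⟨e, rfl⟩ : ∃ e, m = t + 1 + e := ⟨m - t - 1, by omega⟩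
    rw [Finset.prod_range_add, Finset.prod_range_succ, Finset.prod_eq_one]
    · have e1 : t + 1 + e - t - 1 = e := by omega
      have e2 : ∀ k, ¬ t + 1 + k < t := by omega
      have e3 : ∀ k, t + 1 + k ≠ t := by omega
      simp [e1, e2, e3]
    · intro k hk
      exact if_pos (Finset.mem_range.1 hk)
  · refine Finset.prod_eq_one fun k hk => if_pos ?_
    have := Finset.mem_range.1 hk
    omega

theorem sum_card_compl_initialBox_le {F : Type*} [Zero F] [Fintype F] [DecidableEq F]
    (L : Finset F) {t m : ℕ} (htm : t ≤ m) :
    ∑ j, ((initialBox L t m j)ᶜ).card ≤ t * (Fintype.card F - 1) + (Lᶜ).card := by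
  have h : ∀ j : Fin m, ((initialBox L t m j)ᶜ).card =
      (fun k : ℕ => if k < t then Fintype.card F - 1 else if k = t then (Lᶜ).card else 0) j := by
    intro j
    simp only [initialBox]
    split_ifs <;> simp [Finset.card_compl]
  rw [Finset.sum_congr rfl fun j _ => h j,
    Fin.sum_univ_eq_sum_range
      (fun k : ℕ => if k < t then Fintype.card F - 1 else if k = t then (Lᶜ).card else 0) m]
  obtain ⟨e, rfl⟩ : ∃ e, m = t + e := ⟨m - t, by omega⟩
  rw [Finset.sum_range_add]
  refine add_le_add ?_ ?_
  · rw [Finset.sum_congr rfl fun k hk => if_pos (Finset.mem_range.1 hk)]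
    simp
  · simp only [add_lt_iff_neg_left, not_lt_zero, if_false, Nat.add_eq_left,
      Finset.sum_ite_eq']
    split_ifs <;> simp

/-- The polynomial with support the box `∏ j, B j`. -/
noncomputable def boxPolynomial {σ F : Type*} [Fintype σ] [Field F] [Fintype F] [DecidableEq F]
    (B : σ → Finset F) : MvPolynomial σ F :=
  ∏ j, ∏ a ∈ (B j)ᶜ, (MvPolynomial.X j - MvPolynomial.C a)

theorem eval_boxPolynomial_ne_zero {σ F : Type*} [Fintype σ] [Field F] [Fintype F] [DecidableEq F]
    {B : σ → Finset F} {x : σ → F} :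
    MvPolynomial.eval x (boxPolynomial B) ≠ 0 ↔ ∀ j, x j ∈ B j := by
  simp only [boxPolynomial, map_prod, map_sub, MvPolynomial.eval_X, MvPolynomial.eval_C,
    Finset.prod_ne_zero_iff, Finset.mem_univ, true_imp_iff, Finset.mem_compl, sub_ne_zero]
  refine forall_congr' fun j => ⟨fun h => ?_, fun h a ha hxa => ha (hxa ▸ h)⟩
  by_contra hj
  exact h _ hj rfl

theorem totalDegree_boxPolynomial_le {σ F : Type*} [Fintype σ] [Field F] [Fintype F]
    [DecidableEq F] (B : σ → Finset F) :
    (boxPolynomial B).totalDegree ≤ ∑ j, ((B j)ᶜ).card := by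
  refine (MvPolynomial.totalDegree_finsetProd _ _).trans (Finset.sum_le_sum fun j _ => ?_)
  refine (MvPolynomial.totalDegree_finsetProd _ _).trans ?_
  rw [Finset.card_eq_sum_ones]
  refine Finset.sum_le_sum fun a _ => ?_
  exact (MvPolynomial.totalDegree_sub_C_le _ _).trans (MvPolynomial.totalDegree_X _).le

/-- A minimum weight codeword of the Reed–Muller code supported on an initial segment. -/
theorem exists_mem_reedMullerCode_initial {F : Type*} [Field F] [Fintype F] [LinearOrder F]
    (hzero : ∀ a : F, 0 ≤ a) {t s m r : ℕ} (htm : t ≤ m) (hs : s < Fintype.card F - 1)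
    (hr : t * (Fintype.card F - 1) + s ≤ r) :
    ∃ c ∈ reedMullerCode F r m, c ≠ 0 ∧ ∀ i, c i ≠ 0 →
      (i : ℕ) < if t < m then (Fintype.card F - s) * Fintype.card F ^ (m - t - 1) else 1 := by
  -- With `q - s` elements kept, coordinate `t` (if `t < m`) costs `s` linear factors, and each
  -- earlier coordinate costs `q - 1`.
  obtain ⟨L, hL, hLcard⟩ := exists_isLowerSet_card_eq F (k := Fintype.card F - s) (by omega)
  have h0L : (0 : F) ∈ L := by
    obtain ⟨a, ha⟩ : L.Nonempty := Finset.card_pos.1 (by omega)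
    exact hL (hzero a) ha
  have hmem : ∀ i : Fin (Fintype.card F ^ m),
      MvPolynomial.eval (ofLex (lexPoint F m i)) (boxPolynomial (initialBox L t m)) ≠ 0 ↔
        ∀ j, ofLex (lexPoint F m i) j ∈ initialBox L t m j := fun i => eval_boxPolynomial_ne_zero
  refine ⟨_, mem_reedMullerCode.2 ⟨boxPolynomial (initialBox L t m), ?_, rfl⟩, ?_, ?_⟩
  · refine (totalDegree_boxPolynomial_le _).trans ((sum_card_compl_initialBox_le L htm).trans ?_)
    rw [Finset.card_compl]
    omega
  · refine Function.ne_iff.2 ⟨(lexPoint F m).symm (toLex 0), ?_⟩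
    refine (hmem _).2 fun j => ?_
    simp only [OrderIso.apply_symm_apply, ofLex_toLex, Pi.zero_apply, initialBox]
    split_ifs <;> simp [h0L]
  · intro i hi
    -- The indices of the points in the box form a lower set, so each of them is smaller than the
    -- size of the box.
    let T : Finset (Fin (Fintype.card F ^ m)) :=
      Finset.univ.filter fun i => ∀ j, ofLex (lexPoint F m i) j ∈ initialBox L t m j
    have hT : IsLowerSet (T : Set (Fin (Fintype.card F ^ m))) := by
      intro i i' hii' hi
      simp only [T, Finset.coe_filter, Finset.mem_univ, true_and, Set.mem_ofPred_eq] at hi ⊢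
      exact isLowerSet_initialBox hzero hL ((lexPoint F m).monotone hii') hi
    have hTcard : T.card ≤ ∏ j, (initialBox L t m j).card := by
      rw [← Fintype.card_piFinset]
      refine Finset.card_le_card_of_injOn (fun i => ofLex (lexPoint F m i)) ?_ ?_
      · intro i hi
        exact Fintype.mem_piFinset.2 (Finset.mem_filter.1 hi).2
      · intro i _ j _ hij
        exact (lexPoint F m).injective (ofLex.injective hij)
    rw [card_initialBox, hLcard] at hTcard
    refine (val_lt_card_of_isLowerSet hT ?_).trans_le hTcard
    exact Finset.mem_filter.2 ⟨Finset.mem_univ i, (hmem i).1 hi⟩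

/-! ### The minimum `b`-symbol distance. -/

/-- Linearity turns distances into weights; the initial word meets the general lower bound, which
increases with the Hamming weight. -/
theorem minBSymbolDist_eq {F : Type*} [Field F] [DecidableEq F] {n b d : ℕ}
    {C : Submodule F (Fin n → F)} (hb : 1 ≤ b)
    (hlow : ∀ c ∈ C, c ≠ 0 → d ≤ (Finset.univ.filter fun i => c i ≠ 0).card)
    (hupp : ∃ c ∈ C, c ≠ 0 ∧ ∀ i, c i ≠ 0 → (i : ℕ) < d) :
    minBSymbolDist b C = min (d + b - 1) n := by
  obtain ⟨c, hc, hc0, hcd⟩ := hupp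
  have hmem : bSymbolWeight b c ∈
      {d : ℕ | ∃ c ∈ C, ∃ c' ∈ C, c ≠ c' ∧ bSymbolDist b c c' = d} :=
    ⟨c, hc, 0, C.zero_mem, hc0, by rw [bSymbolDist, sub_zero]⟩
  apply le_antisymm
  · exact (Nat.sInf_le hmem).trans
      (le_min (bSymbolWeight_le_of_initial hb hcd) (bSymbolWeight_le_length b c))
  · obtain ⟨x, hx, y, hy, hxy, h⟩ := Nat.sInf_mem ⟨_, hmem⟩
    rw [minBSymbolDist, ← h]
    have hne : x - y ≠ 0 := sub_ne_zero.2 hxy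
    have h1 := hlow _ (C.sub_mem hx hy) hne
    exact le_trans (min_le_min_right _ (by omega)) (le_bSymbolWeight hne hb)

theorem theorem4p6 {F : Type*} [Field F] [Fintype F] [LinearOrder F]
    (hzero : ∀ a : F, 0 ≤ a)
    (q m r t s b : ℕ) (hq : Fintype.card F = q) (hm : 1 ≤ m)
    (hr : r = t * (q - 1) + s) (hs : s < q - 1)
    (hb : 1 ≤ b) (hbn : b ≤ q ^ m) :
    (r ≤ m * (q - 1) →
      (minBSymbolDist b (reedMullerCode F r m) : ℚ) =
        min (((q : ℚ) - (s : ℚ)) * (q : ℚ) ^ ((m : ℤ) - (t : ℤ) - 1) + (b : ℚ) - 1)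
          ((q : ℚ) ^ m)) ∧
    (m * (q - 1) ≤ r → minBSymbolDist b (reedMullerCode F r m) = b) := by
  subst hq
  have hfull : m * (Fintype.card F - 1) ≤ r → minBSymbolDist b (reedMullerCode F r m) = b := by
    intro hmr
    -- For `t = m` and `s = 0` the box is the single point `0`, so the codeword has Hamming weight
    -- 1.
    have hupp := exists_mem_reedMullerCode_initial hzero (s := 0) le_rfl (by omega) hmr
    rw [if_neg (lt_irrefl m)] at hupp
    have h := minBSymbolDist_eq hb (C := reedMullerCode F r m) (d := 1)
      (fun c hc h0 => (minReedMullerWeight_pos (by omega) _ _).trans_le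
        (le_card_support_of_mem_reedMullerCode hc h0)) hupp
    rw [h, Nat.add_sub_cancel_left, min_eq_left hbn]
  refine ⟨fun hrm => ?_, hfull⟩
  have hq0 : (Fintype.card F : ℚ) ≠ 0 := by
    have : Fintype.card F ≠ 0 := by omega
    exact_mod_cast this
  have htm : t ≤ m := by
    by_contra! h
    have := Nat.mul_le_mul_right (Fintype.card F - 1) (show m + 1 ≤ t from h)
    rw [add_mul] at this
    omega
  rcases htm.lt_or_eq with htm | rfl
  · have h := minBSymbolDist_eq hb (C := reedMullerCode F r m)
      (fun c hc h0 => le_card_support_of_mem_reedMullerCode hc h0)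
      (by
        rw [hr, minReedMullerWeight_eq hs]
        exact exists_mem_reedMullerCode_initial hzero htm.le hs le_rfl)
    have e : (m : ℤ) - t - 1 = ((m - t - 1 : ℕ) : ℤ) := by omega
    have hpos := minReedMullerWeight_pos (q := Fintype.card F) (by omega) r m
    rw [h, Nat.cast_min, Nat.cast_sub (by omega), e, zpow_natCast]
    conv_lhs => rw [hr, minReedMullerWeight_eq hs, if_pos htm]
    push_cast [show s ≤ Fintype.card F by omega]
    rfl
  -- At `t = m` the degree bound forces `s = 0`. The exponent is then `-1`, and `q * q⁻¹ = 1` makes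
  -- the formula agree with the value `b`.
  · have hs0 : s = 0 := by omega
    have hbq : (b : ℚ) ≤ (Fintype.card F : ℚ) ^ t := by exact_mod_cast hbn
    rw [hfull (by omega), hs0]
    simp [hq0, hbq]
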